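/- **Setting.** Let $(C_i)_{i\in\mathbb N}$ be a family of CSS codes, $C_i$ acting on $n=n_i$ qubits with $n_i\to\infty$, given by parity check matrices $H_X\in\mathbb F_2^{m_X\times n}$, $H_Z\in\mathbb F_2^{m_Z\times n}$ with $H_XH_Z^T=0$. The checks are $X^{h}$ for the rows $h$ of $H_X$ and $Z^{h}$ for the rows $h$ of $H_Z$, where $X^{a}=\prod_jX_j^{a_j}$ and $Z^{a}=\prod_jZ_j^{a_j}$; the code states are the normalized states fixed by all checks, i.e. the ground states of the associated code Hamiltonian. Assume: - (LDPC) the weights of all rows and of all columns of $H_X$ and $H_Z$ are bounded by constants $w_{\rm check}$, $w_{\rm bit}$ independent of $i$; - (finite rate) there is $r>0$ with $k:=n-\operatorname{rank}H_X-\operatorname{rank}H_Z\ge r\,n$ for all sufficiently large $i$; - (linear $(\delta,\gamma)$-confinement) $\gamma>0$ is a constant, $\delta:\mathbb N\to\mathbb R$ is nondecreasing with $\delta(n)\to\infty$ and $\log n/\delta(n)\to0$, and for every code of the family and all $x,z\in\mathbb F_2^n$, $$\|x\|_X\le\delta(n)\Rightarrow|H_Zx|\ge\gamma\|x\|_X,\qquad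 \|z\|_Z\le\delta(n)\Rightarrow|H_Xz|\ge\gamma\|z\|_Z .$$ Here $|\cdot|$ is the Hamming weight, $\|x\|_X=\min_{a\in\operatorname{Im}H_X^T}|x+a|$ and $\|z\|_Z=\min_{a\in\operatorname{Im}H_Z^T}|z+a|$. **The subspace $\mathcal V$.** Join two distinct qubits by an edge if they take part in a common check (of either type). For a set $A$ of qubits let ${\rm MaxConn}_{1/2}(A)$ be the largest size of a connected set $B$ of qubits with $|A\cap B|\ge\frac12|B|$ ($0$ if there is none). For $x_0\in\mathbb F_2^n$ let $\Omega_X(x_0)$ be the set of all $x_0+x$ such that some minimum-weight element $x|_{\rm red}$ of $x+\operatorname{Im}H_X^T$ satisfies ${\rm MaxConn}_{1/2}(\operatorname{supp}x|_{\rm red})\le\frac12\delta(n)$; define $\Omega_Z(z_0)$ in the same way with $H_Z$. For a code state $|\psi\rangle$ (the reference ground state) and $x_0,z_0\in\mathbb F_2^n$ consider the eigenstate $|x_0,z_0\rangle=X^{x_0}Z^{z_0}|\psi\rangle$ and put $$\mathcal V(x_0,z_0)=\operatorname{span}\{X^{x}Z^{z}|\psi\rangle : x\in\Omega_X(x_0),\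 z\in\Omega_Z(z_0)\}.$$ **Circuits.** A unitary circuit of depth $D$ is a product of $D$ layers, each layer being a product of unitary gates acting on pairwise disjoint sets of at most $q$ qubits, with no geometric restriction. It prepares $|\phi\rangle$ if it maps $|0\rangle^{\otimes(n+a)}$, for some number $a\ge0$ of ancilla qubits, to $|\phi\rangle\otimes|\chi\rangle$ for some ancilla state $|\chi\rangle$. **Theorem.** For every $q$ there is a constant $c>0$ such that, for all sufficiently large $i$, the following holds for every reference ground state $|\psi\rangle$ of $C_i$, all $x_0,z_0\in\mathbb F_2^{n}$ and every state $|\phi\rangle\in\mathcal V(x_0,z_0)$: every unitary circuit with gates on at most $q$ qubits that prepares $|\phi\rangle$ has depth at least $c\log_2\delta(n)$. -/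

import Mathlib

open Filter Topology
open scoped Matrix

/-- Binary vectors indexed by `Q`. They label both computational basis states and Pauli strings. -/
abbrev BitVec2 (Q : Type) : Type := Q → ZMod 2

/-- The (complex) amplitudes of a pure state of the qubits `Q` in the computational basis. -/
abbrev QState (Q : Type) : Type := BitVec2 Q → ℂ

/-- The Pauli string `X^a = ∏ⱼ Xⱼ^{aⱼ}`; it maps the basis state `|t⟩` to `|t + a⟩`. -/
def pauliX {Q : Type} (a : BitVec2 Q) (ψ : QState Q) : QState Q :=
  fun s => ψ (s + a)

/-- The Pauli string `Z^b = ∏ⱼ Zⱼ^{bⱼ}`; it maps `|t⟩` to `(-1)^{b·t} |t⟩`. -/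
def pauliZ {Q : Type} [Fintype Q] (b : BitVec2 Q) (ψ : QState Q) : QState Q :=
  fun s => (-1 : ℂ) ^ (b ⬝ᵥ s).val * ψ s

/-- A CSS code on `n` qubits: two parity check matrices over `𝔽₂` with `H_X H_Zᵀ = 0`. -/
structure CSSCode (n : ℕ) where
  mX : ℕ
  mZ : ℕ
  HX : Matrix (Fin mX) (Fin n) (ZMod 2)
  HZ : Matrix (Fin mZ) (Fin n) (ZMod 2)
  comm : HX * HZᵀ = 0

/-- Number of logical qubits `k = n - rank H_X - rank H_Z`
(the truncated subtraction is harmless, since `H_X H_Zᵀ = 0` gives `rank H_X + rank H_Z ≤ n`). -/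
noncomputable def CSSCode.numLogical {n : ℕ} (C : CSSCode n) : ℕ :=
  n - C.HX.rank - C.HZ.rank

/-- Code states, i.e. ground states of the code Hamiltonian: the normalized states fixed by every
check `S_{X,i} = X^{(H_X)_i}` and every check `S_{Z,i} = Z^{(H_Z)_i}`. -/
structure CSSCode.IsCodeState {n : ℕ} (C : CSSCode n) (ψ : QState (Fin n)) : Prop where
  normalized : ∑ s, ‖ψ s‖ ^ 2 = 1
  checkX : ∀ i, pauliX (C.HX i) ψ = ψ
  checkZ : ∀ i, pauliZ (C.HZ i) ψ = ψ

/-- All rows of `H` have weight at most `wCheck`, and all columns weight at most `wBit`. -/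
def HasDegreesLE {m n : ℕ} (H : Matrix (Fin m) (Fin n) (ZMod 2)) (wCheck wBit : ℕ) : Prop :=
  (∀ i, hammingNorm (fun j => H i j) ≤ wCheck) ∧ (∀ j, hammingNorm (fun i => H i j) ≤ wBit)

/-- The reduced weight of `x`: the Hamming distance of `x` to the image of `Hᵀ`. -/
noncomputable def reducedWeight {m n : ℕ} (H : Matrix (Fin m) (Fin n) (ZMod 2))
    (x : BitVec2 (Fin n)) : ℕ :=
  ⨅ u : Fin m → ZMod 2, hammingNorm (x + Hᵀ *ᵥ u)

/-- Boundary and coboundary confinement of a CSS code, for errors of reduced weight at most `d`. -/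
def CSSCode.Confines {n : ℕ} (C : CSSCode n) (d γ : ℝ) : Prop :=
  (∀ x : BitVec2 (Fin n), (reducedWeight C.HX x : ℝ) ≤ d →
      γ * (reducedWeight C.HX x : ℝ) ≤ (hammingNorm (C.HZ *ᵥ x) : ℝ)) ∧
  (∀ z : BitVec2 (Fin n), (reducedWeight C.HZ z : ℝ) ≤ d →
      γ * (reducedWeight C.HZ z : ℝ) ≤ (hammingNorm (C.HX *ᵥ z) : ℝ))

/-- The interaction graph: two distinct qubits are adjacent if they take part in a common check
(of either type). -/
def CSSCode.interactionGraph {n : ℕ} (C : CSSCode n) : SimpleGraph (Fin n) where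
  Adj j k := j ≠ k ∧
    ((∃ i, C.HX i j ≠ 0 ∧ C.HX i k ≠ 0) ∨ (∃ i, C.HZ i j ≠ 0 ∧ C.HZ i k ≠ 0))
  symm := ⟨fun _ _ h => ⟨h.1.symm,
    h.2.imp (fun ⟨i, hi⟩ => ⟨i, hi.2, hi.1⟩) (fun ⟨i, hi⟩ => ⟨i, hi.2, hi.1⟩)⟩⟩
  loopless := ⟨fun _ h => h.1 rfl⟩

/-- The support of a binary vector. -/
def bitSupport {n : ℕ} (x : BitVec2 (Fin n)) : Finset (Fin n) :=
  Finset.univ.filter fun j => x j ≠ 0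

open Classical in
/-- The size of the largest connected `α`-subset of `A`, i.e. of the largest vertex set `B`
inducing a connected subgraph of `G` and satisfying `|A ∩ B| ≥ α |B|`; it is `0` if there is none. -/
noncomputable def maxConn {n : ℕ} (G : SimpleGraph (Fin n)) (α : ℝ) (A : Finset (Fin n)) : ℕ :=
  (Finset.univ.filter fun B : Finset (Fin n) =>
    (G.induce (B : Set (Fin n))).Connected ∧ α * (B.card : ℝ) ≤ ((A ∩ B).card : ℝ)).sup Finset.card

/-- `r` is a smallest representative of the class of `x` modulo the image of `Hᵀ`. -/
def IsReducedRep {m n : ℕ} (H : Matrix (Fin m) (Fin n) (ZMod 2)) (x r : BitVec2 (Fin n)) : Prop :=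
  (∃ u : Fin m → ZMod 2, r = x + Hᵀ *ᵥ u) ∧ hammingNorm r = reducedWeight H x

/-- The set `Ω(x₀)` of the vectors `x₀ + x` for which a smallest representative of `x` modulo the
image of `Hᵀ` has no connected `1/2`-subset of more than `d / 2` qubits. -/
def CSSCode.Omega {n : ℕ} (C : CSSCode n) {m : ℕ} (H : Matrix (Fin m) (Fin n) (ZMod 2)) (d : ℝ)
    (x₀ : BitVec2 (Fin n)) : Set (BitVec2 (Fin n)) :=
  {y | ∃ x r : BitVec2 (Fin n), y = x₀ + x ∧ IsReducedRep H x r ∧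
    (maxConn C.interactionGraph (1 / 2) (bitSupport r) : ℝ) ≤ d / 2}

/-- The subspace `𝒱(x₀, z₀)` around the eigenstate `|x₀, z₀⟩ = X^{x₀} Z^{z₀} |ψ⟩`, where `ψ` is the
reference ground state and `d` the value of the confinement function. -/
def CSSCode.V {n : ℕ} (C : CSSCode n) (d : ℝ) (ψ : QState (Fin n)) (x₀ z₀ : BitVec2 (Fin n)) :
    Submodule ℂ (QState (Fin n)) :=
  Submodule.span ℂ {φ | ∃ x ∈ C.Omega C.HX d x₀, ∃ z ∈ C.Omega C.HZ d z₀,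
    φ = pauliX x (pauliZ z ψ)}

/-- Operators on the Hilbert space of the qubits `Q`, as matrices in the computational basis. -/
abbrev QOp (Q : Type) : Type := Matrix (BitVec2 Q) (BitVec2 Q) ℂ

open Classical in
/-- `U` acts only on the qubits in `S`: it is `M ⊗ 1` for some operator `M` of these qubits. -/
def ActsOn {Q : Type} (S : Finset Q) (U : QOp Q) : Prop :=
  ∃ M : QOp S, ∀ s t : BitVec2 Q,
    U s t = if ∀ j, j ∉ S → s j = t j then M (fun j => s j) (fun j => t j) else 0

/-- A single layer of a circuit: a product of unitary gates that act on pairwise disjoint sets of at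
most `q` qubits each. -/
def IsLayer {Q : Type} [Fintype Q] [DecidableEq Q] (q : ℕ) (U : QOp Q) : Prop :=
  ∃ gates : List (Finset Q × QOp Q),
    gates.Pairwise (fun g h => Disjoint g.1 h.1) ∧
    (∀ g ∈ gates, g.1.card ≤ q ∧ g.2 ∈ Matrix.unitaryGroup (BitVec2 Q) ℂ ∧ ActsOn g.1 g.2) ∧
    U = (gates.map Prod.snd).prod

/-- A unitary circuit of depth `D` made of gates that act on at most `q` qubits. -/
def IsCircuit {Q : Type} [Fintype Q] [DecidableEq Q] (q D : ℕ) (U : QOp Q) : Prop :=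
  ∃ layers : List (QOp Q), layers.length = D ∧ (∀ L ∈ layers, IsLayer q L) ∧ U = layers.prod

/-- The state `|0…0⟩`. -/
def zeroState (Q : Type) [Fintype Q] [DecidableEq Q] : QState Q :=
  Pi.single 0 1

/-- The state `φ` of `n` qubits can be prepared by a unitary circuit of depth `D` with gates on at
most `q` qubits: acting on `|0…0⟩` of the `n` qubits and some number `a` (possibly `0`) of ancilla
qubits, the circuit yields `φ ⊗ χ` for some state `χ` of the ancillas. -/
def Preparable {n : ℕ} (q D : ℕ) (φ : QState (Fin n)) : Prop :=
  ∃ (a : ℕ) (U : QOp (Fin n ⊕ Fin a)) (χ : QState (Fin a)), IsCircuit q D U ∧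
    U *ᵥ zeroState (Fin n ⊕ Fin a) = fun s => φ (fun j => s (Sum.inl j)) * χ (fun j => s (Sum.inr j))

/-!
The states of `𝒱(x₀, z₀)` are the vectors `R ψ`, where `R` runs over the span of the Pauli strings
`X^x Z^z` with `x ∈ Ω_X(x₀)` and `z ∈ Ω_Z(z₀)`. The point is that these errors, together with any
operator `A` supported on few qubits, satisfy the Knill–Laflamme conditions: `⟨R ψ₁, A R ψ₂⟩` is
`⟨ψ₁, ψ₂⟩` times a scalar that does not depend on the code vectors `ψ₁, ψ₂`
(`exists_scalar_error_pauli_error`, `exists_scalar_error_supportedOps_error`).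

For Pauli strings this says that a product `X^{x + a + x'}` with `x, x' ∈ Ω_X(x₀)` and `a` of low
weight either violates a `Z`-check or is a product of `X`-checks, and likewise for `Z`. Up to
stabilizers, `x + x'` is the sum of two reduced errors, and each connected subset of its support is
at least half filled by one of the two, so it has at most `δ / 2` elements. Confinement therefore
applies to every connected component, and because no check meets two components the bounds add up:
the reduced weight of `x + x'` is at most `1 / γ` times its syndrome
(`confinement_of_connected_card_le`). If `x + a + x'` has trivial syndrome, the syndrome of `x + x'`
is that of `a`, hence small; so `x + a + x'` has reduced weight at most `δ`, and confinement forces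
it to be a stabilizer (`exists_stabilizer_of_syndrome_eq_zero`).

Suppose now that a circuit `U` of depth `D` prepares `Φ = φ ⊗ χ` with `φ = R ψ`. Then `Φ` is, up to
scalars, the only vector annihilated by all `U Π_j Uᴴ` with `Π_j = |1⟩⟨1|_j`
(`exists_eq_smul_of_expectation_eq_zero`), and each of these operators is supported on at most
`(q + 1) ^ D` qubits (`IsCircuit.exists_support_conj`). Since the code has a logical qubit, there is
a nonzero code vector `ψ'` orthogonal to `ψ`. If `(q + 1) ^ D (1 + wBit / γ) ≤ δ`, the Knill–Laflamme
conditions show that `R ψ' ⊗ χ` is nonzero, orthogonal to `Φ`, and also annihilated by all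
`U Π_j Uᴴ`, a contradiction (`not_preparable_of_mem_V`). Hence `D` is at least of order `log δ`.
-/

/-! ### Signs and Pauli strings -/

/-- The character `x ↦ (-1)^x` of `𝔽₂`. -/
def bitSign (x : ZMod 2) : ℂ := (-1 : ℂ) ^ x.val

@[simp] lemma bitSign_zero : bitSign 0 = 1 := by simp [bitSign]

@[simp] lemma bitSign_one : bitSign 1 = -1 := by simp [bitSign, ZMod.val_one]

lemma zmod_two_eq_zero_or_one : ∀ x : ZMod 2, x = 0 ∨ x = 1 := by decide

lemma bitSign_add (x y : ZMod 2) : bitSign (x + y) = bitSign x * bitSign y := by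
  rcases zmod_two_eq_zero_or_one x with rfl | rfl <;>
    rcases zmod_two_eq_zero_or_one y with rfl | rfl <;> simp [CharTwo.add_self_eq_zero]

@[simp] lemma star_bitSign (x : ZMod 2) : star (bitSign x) = bitSign x := by
  simp [bitSign]

lemma bitVec2_add_self {Q : Type} (a : BitVec2 Q) : a + a = 0 := by
  ext j
  exact CharTwo.add_self_eq_zero (a j)

lemma bitVec2_eq_add_iff {Q : Type} (s t a : BitVec2 Q) : t = s + a ↔ s = t + a := by
  constructor <;> rintro rfl <;> rw [add_assoc, bitVec2_add_self, add_zero]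

section Pauli

variable {Q : Type} [Fintype Q]

/-- The matrix of the Pauli string `X^a Z^b`. -/
def pauli (a b : BitVec2 Q) : QOp Q :=
  Matrix.of fun s t => if t = s + a then bitSign (b ⬝ᵥ t) else 0

lemma pauli_apply (a b s t : BitVec2 Q) :
    pauli a b s t = if t = s + a then bitSign (b ⬝ᵥ t) else 0 := rfl

lemma pauli_zero_zero : pauli (0 : BitVec2 Q) 0 = 1 := by
  ext s t
  simp [pauli_apply, Matrix.one_apply, eq_comm]

lemma pauli_conjTranspose (a b : BitVec2 Q) :
    (pauli a b)ᴴ = bitSign (b ⬝ᵥ a) • pauli a b := by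
  ext s t
  simp only [Matrix.conjTranspose_apply, pauli_apply, Matrix.smul_apply, smul_eq_mul, mul_ite,
    mul_zero, bitVec2_eq_add_iff t s a]
  split_ifs with h
  · subst h
    simp only [star_bitSign, ← bitSign_add, dotProduct_add]
    congr 1
    generalize b ⬝ᵥ s = x
    generalize b ⬝ᵥ a = y
    revert x y
    decide
  · simp

section

variable [DecidableEq Q]

lemma pauli_mulVec_apply (a b : BitVec2 Q) (φ : QState Q) (s : BitVec2 Q) :
    (pauli a b *ᵥ φ) s = bitSign (b ⬝ᵥ (s + a)) * φ (s + a) := by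
  simp [Matrix.mulVec, dotProduct, pauli_apply]

lemma pauli_mulVec (a b : BitVec2 Q) (φ : QState Q) :
    pauli a b *ᵥ φ = pauliX a (pauliZ b φ) := by
  ext s
  rw [pauli_mulVec_apply]
  rfl

lemma pauli_mul (a b a' b' : BitVec2 Q) :
    pauli a b * pauli a' b' = bitSign (b ⬝ᵥ a') • pauli (a + a') (b + b') := by
  ext s t
  simp only [Matrix.mul_apply, pauli_apply, ite_mul, zero_mul, Finset.sum_ite_eq',
    Finset.mem_univ, if_true]
  simp only [Matrix.smul_apply, pauli_apply, smul_eq_mul, mul_ite, mul_zero, ← add_assoc]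
  split_ifs with h
  · rw [(bitVec2_eq_add_iff (s + a) t a').1 h, dotProduct_add, add_dotProduct, bitSign_add,
      bitSign_add]
    ring
  · rfl

end

/-! ### Operators supported on a set of qubits -/

/-- The operators supported on `T`, described as the span of the Pauli strings supported on `T`. -/
def supportedOps (T : Finset Q) : Submodule ℂ (QOp Q) :=
  Submodule.span ℂ {P | ∃ a b : BitVec2 Q, (∀ j, j ∉ T → a j = 0) ∧ (∀ j, j ∉ T → b j = 0) ∧
    P = pauli a b}

lemma pauli_mem_supportedOps {T : Finset Q} {a b : BitVec2 Q} (ha : ∀ j, j ∉ T → a j = 0)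
    (hb : ∀ j, j ∉ T → b j = 0) : pauli a b ∈ supportedOps T :=
  Submodule.subset_span ⟨a, b, ha, hb, rfl⟩

lemma supportedOps_mono {T T' : Finset Q} (h : T ⊆ T') : supportedOps T ≤ supportedOps T' := by
  refine Submodule.span_mono ?_
  rintro _ ⟨a, b, ha, hb, rfl⟩
  exact ⟨a, b, fun j hj => ha j fun hT => hj (h hT), fun j hj => hb j fun hT => hj (h hT), rfl⟩

lemma one_mem_supportedOps (T : Finset Q) : (1 : QOp Q) ∈ supportedOps T := by
  rw [← pauli_zero_zero]
  exact pauli_mem_supportedOps (fun _ _ => rfl) (fun _ _ => rfl)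

lemma conjTranspose_mem_supportedOps {T : Finset Q} {A : QOp Q} (hA : A ∈ supportedOps T) :
    Aᴴ ∈ supportedOps T := by
  induction hA using Submodule.span_induction with
  | mem P hP =>
    obtain ⟨a, b, ha, hb, rfl⟩ := hP
    rw [pauli_conjTranspose]
    exact Submodule.smul_mem _ _ (pauli_mem_supportedOps ha hb)
  | zero => simp
  | add A B _ _ hA hB =>
    rw [Matrix.conjTranspose_add]
    exact Submodule.add_mem _ hA hB
  | smul c A _ hA =>
    rw [Matrix.conjTranspose_smul]
    exact Submodule.smul_mem _ _ hA

variable [DecidableEq Q]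

lemma mul_mem_supportedOps {T : Finset Q} {A B : QOp Q} (hA : A ∈ supportedOps T)
    (hB : B ∈ supportedOps T) : A * B ∈ supportedOps T := by
  have h : supportedOps T * supportedOps T ≤ supportedOps T := by
    conv_lhs => rw [supportedOps, Submodule.span_mul_span]
    rw [Submodule.span_le]
    rintro _ ⟨_, ⟨a, b, ha, hb, rfl⟩, _, ⟨a', b', ha', hb', rfl⟩, rfl⟩
    simp only [pauli_mul]
    refine Submodule.smul_mem _ _ (pauli_mem_supportedOps ?_ ?_)
    · intro j hj
      simp [ha j hj, ha' j hj]
    · intro j hj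
      simp [hb j hj, hb' j hj]
  exact h (Submodule.mul_mem_mul hA hB)

lemma commute_of_disjoint_supportedOps {S T : Finset Q} (hST : Disjoint S T) {A B : QOp Q}
    (hA : A ∈ supportedOps S) (hB : B ∈ supportedOps T) : Commute A B := by
  have hdot : ∀ {S T : Finset Q}, Disjoint S T → ∀ {a b : BitVec2 Q}, (∀ j, j ∉ S → a j = 0) →
      (∀ j, j ∉ T → b j = 0) → a ⬝ᵥ b = 0 := by
    intro S T hST a b ha hb
    refine Finset.sum_eq_zero fun j _ => ?_
    by_cases hj : j ∈ S
    · rw [hb j (Finset.disjoint_left.1 hST hj), mul_zero]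
    · rw [ha j hj, zero_mul]
  induction hA using Submodule.span_induction with
  | mem P hP =>
    obtain ⟨a, b, ha, hb, rfl⟩ := hP
    induction hB using Submodule.span_induction with
    | mem P hP =>
      obtain ⟨a', b', ha', hb', rfl⟩ := hP
      rw [commute_iff_eq, pauli_mul, pauli_mul, hdot hST hb ha', hdot hST.symm hb' ha, add_comm a,
        add_comm b]
    | zero => exact Commute.zero_right _
    | add A B _ _ hA hB => exact hA.add_right hB
    | smul c A _ hA => exact hA.smul_right c
  | zero => exact Commute.zero_left _
  | add A B _ _ hA hB => exact hA.add_left hB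
  | smul c A _ hA => exact hA.smul_left c

/-- The projector onto the basis states that agree with `u` on `S'` is a product of the commuting
projectors `(1 ± Z_j) / 2`. -/
lemma diagonal_agree_mem_supportedOps {S S' : Finset Q} (h : S' ⊆ S) (u : BitVec2 Q) :
    Matrix.diagonal (fun t : BitVec2 Q => if ∀ j ∈ S', t j = u j then (1 : ℂ) else 0) ∈
      supportedOps S := by
  induction S' using Finset.induction_on with
  | empty =>
    simpa using one_mem_supportedOps S
  | insert i S' _ ih =>
    have hfac : Matrix.diagonal
        (fun t : BitVec2 Q => if ∀ j ∈ insert i S', t j = u j then (1 : ℂ) else 0) =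
        ((1 / 2 : ℂ) • ((1 : QOp Q) + bitSign (u i) • pauli 0 (Pi.single i 1))) *
          Matrix.diagonal (fun t : BitVec2 Q => if ∀ j ∈ S', t j = u j then (1 : ℂ) else 0) := by
      have hdiag : pauli (0 : BitVec2 Q) (Pi.single i 1) =
          Matrix.diagonal fun t => bitSign (t i) := by
        ext s t
        by_cases hst : s = t
        · subst hst
          simp [pauli_apply]
        · simp [pauli_apply, hst, Ne.symm hst]
      have hbit : ∀ x y : ZMod 2,
          (1 / 2 : ℂ) * (1 + bitSign y * bitSign x) = if x = y then 1 else 0 := by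
        intro x y
        rcases zmod_two_eq_zero_or_one x with rfl | rfl <;>
          rcases zmod_two_eq_zero_or_one y with rfl | rfl <;> norm_num
      rw [hdiag, ← Matrix.diagonal_one, ← Matrix.diagonal_smul, Matrix.diagonal_add,
        ← Matrix.diagonal_smul, Matrix.diagonal_mul_diagonal]
      congr 1
      ext t
      simp only [Pi.smul_apply, smul_eq_mul, hbit]
      by_cases h1 : t i = u i <;> simp [h1]
    rw [hfac]
    have hi : i ∈ S := h (Finset.mem_insert_self i S')
    refine mul_mem_supportedOps (Submodule.smul_mem _ _ (Submodule.add_mem _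
      (one_mem_supportedOps S) (Submodule.smul_mem _ _ (pauli_mem_supportedOps (fun _ _ => rfl) ?_))))
      (ih ((Finset.subset_insert i S').trans h))
    intro j hj
    exact Pi.single_eq_of_ne (fun hji : j = i => hj (hji ▸ hi)) _

/-- Extension of a binary vector on `S` by zero. -/
def extendBits (S : Finset Q) (v : BitVec2 S) : BitVec2 Q :=
  fun j => if hj : j ∈ S then v ⟨j, hj⟩ else 0

/-- `M ⊗ 1` is the sum of the operators `M_{s,t} |s⟩⟨t| ⊗ 1`, and `|s⟩⟨t| ⊗ 1` is `X^{s + t}` times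
the projector onto `|t⟩`. -/
lemma ActsOn.mem_supportedOps {S : Finset Q} {U : QOp Q} (h : ActsOn S U) :
    U ∈ supportedOps S := by
  obtain ⟨M, hM⟩ := h
  have hU : U = ∑ u : BitVec2 S, ∑ v : BitVec2 S, M u v •
      (pauli (extendBits S u + extendBits S v) 0 * Matrix.diagonal
        (fun t : BitVec2 Q => if ∀ j ∈ S, t j = extendBits S v j then (1 : ℂ) else 0)) := by
    ext s t
    have hext : ∀ v : BitVec2 S, (∀ j ∈ S, t j = extendBits S v j) ↔
        v = fun j : S => t j := by
      intro v
      constructor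
      · intro hv
        ext j
        rw [hv j j.2]
        simp [extendBits]
      · rintro rfl j hj
        simp [extendBits, hj]
    have hoff : ∀ u : BitVec2 S, (t = s + (extendBits S u + extendBits S fun j : S => t j)) ↔
        ((∀ j, j ∉ S → s j = t j) ∧ u = fun j : S => s j) := by
      intro u
      have h2 : ∀ x y z : ZMod 2, x = y + (z + x) ↔ z = y := by decide
      constructor
      · intro hv
        refine ⟨fun j hj => ?_, ?_⟩
        · have := congrFun hv j
          simpa [extendBits, hj, eq_comm] using this
        · ext j
          have := congrFun hv j
          simpa [extendBits, h2] using this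
      · rintro ⟨hv, rfl⟩
        ext j
        by_cases hj : j ∈ S
        · simp [extendBits, hj, h2]
        · simp [extendBits, hj, hv j hj]
    rw [hM]
    simp only [Matrix.sum_apply, Matrix.smul_apply, Matrix.mul_diagonal, pauli_apply, smul_eq_mul,
      zero_dotProduct, bitSign_zero, hext, mul_ite, mul_one, mul_zero, Finset.sum_ite_eq',
      Finset.mem_univ, if_true, hoff]
    by_cases hst : ∀ j, j ∉ S → s j = t j
    · simp only [if_pos hst, and_iff_right hst, Finset.sum_ite_eq', Finset.mem_univ, if_true]
    · simp only [hst, false_and, if_false, Finset.sum_const_zero]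
  rw [hU]
  refine Submodule.sum_mem _ fun u _ => Submodule.sum_mem _ fun v _ => Submodule.smul_mem _ _
    (mul_mem_supportedOps (pauli_mem_supportedOps ?_ fun _ _ => rfl)
      (diagonal_agree_mem_supportedOps subset_rfl _))
  intro j hj
  simp [extendBits, hj]

/-! ### Light cones -/

/-- Conjugation by a layer enlarges the support only by the gates that meet it: the others commute
past the operator and cancel. The last clause is what keeps the induction over the gates going. -/
lemma exists_support_conj_gates {q : ℕ} (T : Finset Q) {A : QOp Q} (hA : A ∈ supportedOps T)
    (gates : List (Finset Q × QOp Q))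
    (hdisj : gates.Pairwise (fun g h => Disjoint g.1 h.1))
    (hg : ∀ g ∈ gates, g.1.card ≤ q ∧ g.2 ∈ Matrix.unitaryGroup (BitVec2 Q) ℂ ∧
      ActsOn g.1 g.2) :
    ∃ T' G : Finset Q, (gates.map Prod.snd).prod * A * ((gates.map Prod.snd).prod)ᴴ ∈
        supportedOps T' ∧ T'.card ≤ T.card + q * (T ∩ G).card ∧ T' ⊆ T ∪ G ∧
      ∀ S : Finset Q, (∀ g ∈ gates, Disjoint S g.1) → Disjoint S G := by
  induction gates with
  | nil => exact ⟨T, ∅, by simpa using hA, by simp, by simp, by simp⟩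
  | cons g gates ih =>
    rw [List.pairwise_cons] at hdisj
    obtain ⟨T', G, hmem, hcard, hsub, hG⟩ :=
      ih hdisj.2 fun g' hg' => hg g' (List.mem_cons_of_mem _ hg')
    obtain ⟨hq, hunit, hact⟩ := hg g List.mem_cons_self
    have hgG : Disjoint g.1 G := hG g.1 fun g' hg' => hdisj.1 g' hg'
    have hop : ((g :: gates).map Prod.snd).prod * A * (((g :: gates).map Prod.snd).prod)ᴴ =
        g.2 * ((gates.map Prod.snd).prod * A * ((gates.map Prod.snd).prod)ᴴ) * g.2ᴴ := by
      simp only [List.map_cons, List.prod_cons, Matrix.conjTranspose_mul, Matrix.mul_assoc]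
    rw [hop]
    by_cases hgT : Disjoint g.1 T
    · have hcomm := commute_of_disjoint_supportedOps
        ((Finset.disjoint_union_right.2 ⟨hgT, hgG⟩).mono_right hsub) hact.mem_supportedOps hmem
      rw [hcomm.eq, Matrix.mul_assoc _ g.2, ← Matrix.star_eq_conjTranspose g.2,
        Matrix.mem_unitaryGroup_iff.1 hunit, Matrix.mul_one]
      exact ⟨T', G, hmem, hcard, hsub, fun S hS => hG S fun g' hg' =>
        hS g' (List.mem_cons_of_mem _ hg')⟩
    · refine ⟨T' ∪ g.1, G ∪ g.1, ?_, ?_, ?_, ?_⟩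
      · have hgm := supportedOps_mono (Finset.subset_union_right (s₁ := T')) hact.mem_supportedOps
        exact mul_mem_supportedOps (mul_mem_supportedOps hgm
          (supportedOps_mono Finset.subset_union_left hmem)) (conjTranspose_mem_supportedOps hgm)
      · have h1 : 1 ≤ (T ∩ g.1).card := by
          rw [Finset.one_le_card, Finset.inter_comm]
          exact Finset.not_disjoint_iff_nonempty_inter.1 hgT
        have h2 : (T ∩ (G ∪ g.1)).card = (T ∩ G).card + (T ∩ g.1).card := by
          rw [Finset.inter_union_distrib_left, Finset.card_union_of_disjoint]
          exact hgG.symm.mono Finset.inter_subset_right Finset.inter_subset_right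
        calc (T' ∪ g.1).card ≤ T'.card + g.1.card := Finset.card_union_le _ _
          _ ≤ T.card + q * (T ∩ G).card + q * 1 := by omega
          _ ≤ T.card + q * (T ∩ G).card + q * (T ∩ g.1).card := by gcongr
          _ = T.card + q * (T ∩ (G ∪ g.1)).card := by rw [h2]; ring
      · rw [← Finset.union_assoc]
        exact Finset.union_subset_union_left hsub
      · intro S hS
        exact Finset.disjoint_union_right.2 ⟨hG S fun g' hg' =>
          hS g' (List.mem_cons_of_mem _ hg'), hS g List.mem_cons_self⟩

lemma IsLayer.exists_support_conj {q : ℕ} {L : QOp Q} (hL : IsLayer q L) (T : Finset Q) {A : QOp Q}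
    (hA : A ∈ supportedOps T) :
    ∃ T' : Finset Q, T'.card ≤ (q + 1) * T.card ∧ L * A * Lᴴ ∈ supportedOps T' := by
  obtain ⟨gates, hdisj, hg, rfl⟩ := hL
  obtain ⟨T', G, hmem, hcard, -, -⟩ := exists_support_conj_gates T hA gates hdisj hg
  refine ⟨T', hcard.trans ?_, hmem⟩
  have : (T ∩ G).card ≤ T.card := Finset.card_le_card Finset.inter_subset_left
  calc T.card + q * (T ∩ G).card ≤ T.card + q * T.card := by gcongr
    _ = (q + 1) * T.card := by ring

lemma IsLayer.mem_unitaryGroup {q : ℕ} {L : QOp Q} (hL : IsLayer q L) :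
    L ∈ Matrix.unitaryGroup (BitVec2 Q) ℂ := by
  obtain ⟨gates, -, hg, rfl⟩ := hL
  refine Submonoid.list_prod_mem _ fun U hU => ?_
  obtain ⟨g, hgm, rfl⟩ := List.mem_map.1 hU
  exact (hg g hgm).2.1

lemma IsCircuit.mem_unitaryGroup {q D : ℕ} {U : QOp Q} (hU : IsCircuit q D U) :
    U ∈ Matrix.unitaryGroup (BitVec2 Q) ℂ := by
  obtain ⟨layers, -, hL, rfl⟩ := hU
  exact Submonoid.list_prod_mem _ fun L h => (hL L h).mem_unitaryGroup

/-- The light cone of a circuit of depth `D` grows at most like `(q + 1) ^ D`. -/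
lemma IsCircuit.exists_support_conj {q D : ℕ} {U : QOp Q} (hU : IsCircuit q D U) (T : Finset Q)
    {A : QOp Q} (hA : A ∈ supportedOps T) :
    ∃ T' : Finset Q, T'.card ≤ (q + 1) ^ D * T.card ∧ U * A * Uᴴ ∈ supportedOps T' := by
  obtain ⟨layers, rfl, hL, rfl⟩ := hU
  induction layers with
  | nil => exact ⟨T, by simp, by simpa using hA⟩
  | cons L layers ih =>
    obtain ⟨T₁, hcard₁, hmem₁⟩ := ih fun L' hL' => hL L' (List.mem_cons_of_mem _ hL')
    obtain ⟨T₂, hcard₂, hmem₂⟩ := (hL L List.mem_cons_self).exists_support_conj T₁ hmem₁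
    refine ⟨T₂, hcard₂.trans ?_, ?_⟩
    · calc (q + 1) * T₁.card ≤ (q + 1) * ((q + 1) ^ layers.length * T.card) := by gcongr
        _ = (q + 1) ^ (L :: layers).length * T.card := by rw [List.length_cons]; ring
    · convert hmem₂ using 1
      simp only [List.prod_cons, Matrix.conjTranspose_mul, Matrix.mul_assoc]

end Pauli

/-! ### Weights and confinement -/

lemma hammingNorm_add_le {ι : Type} [Fintype ι] (x y : BitVec2 ι) :
    hammingNorm (x + y) ≤ hammingNorm x + hammingNorm y := by
  classical
  refine (Finset.card_le_card ?_).trans (Finset.card_union_le _ _)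
  intro j
  simp only [Finset.mem_filter, Finset.mem_univ, true_and, Finset.mem_union, Pi.add_apply]
  contrapose!
  rintro ⟨h1, h2⟩
  rw [h1, h2, add_zero]

lemma hammingNorm_add_of_disjoint {ι : Type} [Fintype ι] (x y : BitVec2 ι)
    (h : ∀ i, x i = 0 ∨ y i = 0) : hammingNorm (x + y) = hammingNorm x + hammingNorm y := by
  classical
  unfold hammingNorm
  rw [← Finset.card_union_of_disjoint]
  · congr 1
    ext i
    rcases h i with hi | hi <;> simp [hi]
  · rw [Finset.disjoint_left]
    intro i
    rcases h i with hi | hi <;> simp [hi]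

lemma hammingNorm_sum_le {ι κ : Type} [Fintype ι] (s : Finset κ) (f : κ → BitVec2 ι) :
    hammingNorm (∑ k ∈ s, f k) ≤ ∑ k ∈ s, hammingNorm (f k) := by
  classical
  induction s using Finset.induction_on with
  | empty => simp
  | insert k s hk ih =>
    rw [Finset.sum_insert hk, Finset.sum_insert hk]
    exact (hammingNorm_add_le _ _).trans (by omega)

lemma hammingNorm_mulVec_le {m n : ℕ} {H : Matrix (Fin m) (Fin n) (ZMod 2)} {w : ℕ}
    (hcol : ∀ j, hammingNorm (fun i => H i j) ≤ w) (p : BitVec2 (Fin n)) :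
    hammingNorm (H *ᵥ p) ≤ w * hammingNorm p := by
  have hsum : H *ᵥ p = ∑ j ∈ bitSupport p, fun i => H i j * p j := by
    ext i
    rw [Finset.sum_apply, bitSupport, Finset.sum_filter_of_ne]
    · rfl
    · intro j _ h hj
      exact h (by rw [hj, mul_zero])
  rw [hsum]
  refine (hammingNorm_sum_le _ _).trans ?_
  refine (Finset.sum_le_card_nsmul _ _ w fun j _ => ?_).trans (le_of_eq ?_)
  · refine le_trans (Finset.card_le_card ?_) (hcol j)
    intro i
    simp only [Finset.mem_filter, Finset.mem_univ, true_and]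
    exact left_ne_zero_of_mul
  · rw [smul_eq_mul, mul_comm]
    rfl

section ReducedWeight

variable {m n : ℕ} (H : Matrix (Fin m) (Fin n) (ZMod 2))

lemma reducedWeight_le (x : BitVec2 (Fin n)) (u : Fin m → ZMod 2) :
    reducedWeight H x ≤ hammingNorm (x + Hᵀ *ᵥ u) :=
  ciInf_le ⟨0, fun _ _ => Nat.zero_le _⟩ u

lemma exists_reducedWeight_eq (x : BitVec2 (Fin n)) :
    ∃ u : Fin m → ZMod 2, hammingNorm (x + Hᵀ *ᵥ u) = reducedWeight H x :=
  Nat.sInf_mem (Set.range_nonempty fun u : Fin m → ZMod 2 => hammingNorm (x + Hᵀ *ᵥ u))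

lemma reducedWeight_le_hammingNorm (x : BitVec2 (Fin n)) : reducedWeight H x ≤ hammingNorm x := by
  simpa using reducedWeight_le H x 0

lemma reducedWeight_add_le (x y : BitVec2 (Fin n)) :
    reducedWeight H (x + y) ≤ reducedWeight H x + reducedWeight H y := by
  obtain ⟨u, hu⟩ := exists_reducedWeight_eq H x
  obtain ⟨v, hv⟩ := exists_reducedWeight_eq H y
  rw [← hu, ← hv]
  refine (reducedWeight_le H _ (u + v)).trans (le_of_eq_of_le ?_ (hammingNorm_add_le _ _))
  rw [Matrix.mulVec_add, add_add_add_comm]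

lemma exists_eq_of_reducedWeight_eq_zero {x : BitVec2 (Fin n)} (h : reducedWeight H x = 0) :
    ∃ u : Fin m → ZMod 2, x = Hᵀ *ᵥ u := by
  obtain ⟨u, hu⟩ := exists_reducedWeight_eq H x
  rw [h, hammingNorm_eq_zero] at hu
  refine ⟨u, ?_⟩
  have := (bitVec2_eq_add_iff x 0 (Hᵀ *ᵥ u)).1 hu.symm
  rwa [zero_add] at this

end ReducedWeight

/-- Confinement holds for an error of any weight whose connected parts have size at most `d`: no
check meets two different connected components, so the syndromes of the components add up. -/
lemma confinement_of_connected_card_le {m m' n : ℕ} {HR : Matrix (Fin m) (Fin n) (ZMod 2)}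
    {HS : Matrix (Fin m') (Fin n) (ZMod 2)} {G : SimpleGraph (Fin n)}
    (hG : ∀ i j k, j ≠ k → HS i j ≠ 0 → HS i k ≠ 0 → G.Adj j k) {d γ : ℝ}
    (hconf : ∀ x : BitVec2 (Fin n), (reducedWeight HR x : ℝ) ≤ d →
      γ * (reducedWeight HR x : ℝ) ≤ (hammingNorm (HS *ᵥ x) : ℝ)) (hγ : 0 ≤ γ)
    (f : BitVec2 (Fin n)) (hf : ∀ B : Finset (Fin n), B ⊆ bitSupport f →
      (G.induce (B : Set (Fin n))).Connected → (B.card : ℝ) ≤ d) :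
    γ * (reducedWeight HR f : ℝ) ≤ (hammingNorm (HS *ᵥ f) : ℝ) := by
  classical
  induction hN : (bitSupport f).card using Nat.strong_induction_on generalizing f with
  | _ N ih =>
  by_cases hf0 : f = 0
  · subst hf0
    have : reducedWeight HR (0 : BitVec2 (Fin n)) = 0 :=
      Nat.le_zero.1 (by simpa using reducedWeight_le_hammingNorm HR 0)
    simp [this]
  obtain ⟨v, hv⟩ : ∃ v, f v ≠ 0 := Function.ne_iff.1 hf0
  -- A connected subset of the support of maximal size is a connected component of the support.
  obtain ⟨B, hB, hmax⟩ := Finset.exists_max_image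
    ((bitSupport f).powerset.filter fun B : Finset (Fin n) => (G.induce (B : Set (Fin n))).Connected)
    Finset.card
    ⟨{v}, by
      simp only [Finset.mem_filter, Finset.mem_powerset, Finset.singleton_subset_iff]
      refine ⟨by simpa [bitSupport] using hv, ?_⟩
      rw [Finset.coe_singleton, SimpleGraph.induce_singleton_eq_top]
      exact SimpleGraph.connected_top⟩
  rw [Finset.mem_filter, Finset.mem_powerset] at hB
  obtain ⟨hBf, hBconn⟩ := hB
  have hsep : ∀ j ∈ B, ∀ k, f k ≠ 0 → k ∉ B → ¬ G.Adj j k := by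
    intro j hj k hk hkB hadj
    have hconn : (G.induce ((insert k B : Finset (Fin n)) : Set (Fin n))).Connected := by
      have h1 := SimpleGraph.induce_pair_connected_of_adj hadj
      have h2 := SimpleGraph.induce_union_connected (s := {j, k}) (t := (B : Set (Fin n)))
        h1.preconnected hBconn.preconnected ⟨j, by simp, hj⟩
      convert h2 using 2
      all_goals
        ext x
        simp only [Finset.coe_insert, Set.mem_insert_iff, Set.mem_union, Set.mem_singleton_iff,
          Finset.mem_coe]
        constructor
        · tauto
        · rintro ((rfl | h) | h)
          · exact Or.inr hj
          · exact Or.inl h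
          · exact Or.inr h
    have := hmax (insert k B) (by
      rw [Finset.mem_filter, Finset.mem_powerset, Finset.insert_subset_iff]
      exact ⟨⟨by simpa [bitSupport] using hk, hBf⟩, hconn⟩)
    rw [Finset.card_insert_of_notMem hkB] at this
    omega
  obtain ⟨⟨b, hb⟩⟩ := hBconn.nonempty
  set g : BitVec2 (Fin n) := fun j => if j ∈ B then f j else 0 with hg
  set h : BitVec2 (Fin n) := fun j => if j ∈ B then 0 else f j with hh
  have hgh : f = g + h := by
    ext j
    by_cases hj : j ∈ B <;> simp [hg, hh, hj]
  have hgB : bitSupport g = B := by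
    ext j
    have : j ∈ B → f j ≠ 0 := fun hj => by simpa [bitSupport] using hBf hj
    by_cases hj : j ∈ B <;> simp [bitSupport, hg, hj, this]
  have hhsub : bitSupport h ⊆ bitSupport f := by
    intro j
    by_cases hj : j ∈ B <;> simp [bitSupport, hh, hj]
  have hhlt : (bitSupport h).card < N := by
    rw [← hN]
    refine Finset.card_lt_card ⟨hhsub, fun hc => ?_⟩
    have := hc (hBf hb)
    simp only [bitSupport, hh, Finset.mem_filter, Finset.mem_univ, true_and] at this
    exact this (if_pos hb)
  have hsynd : hammingNorm (HS *ᵥ f) = hammingNorm (HS *ᵥ g) + hammingNorm (HS *ᵥ h) := by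
    rw [hgh, Matrix.mulVec_add]
    refine hammingNorm_add_of_disjoint _ _ fun i => ?_
    by_contra! hcon
    obtain ⟨j, -, hj⟩ : ∃ j ∈ Finset.univ, HS i j * g j ≠ 0 :=
      Finset.exists_ne_zero_of_sum_ne_zero hcon.1
    obtain ⟨k, -, hk⟩ : ∃ k ∈ Finset.univ, HS i k * h k ≠ 0 :=
      Finset.exists_ne_zero_of_sum_ne_zero hcon.2
    have hjB : j ∈ B := by
      by_contra hjB
      exact right_ne_zero_of_mul hj (if_neg hjB)
    have hkB : k ∉ B := fun hkB => right_ne_zero_of_mul hk (if_pos hkB)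
    have hfk : f k ≠ 0 := by
      have := right_ne_zero_of_mul hk
      simpa [hh, hkB] using this
    exact hsep j hjB k hfk hkB (hG i j k (fun hjk => hkB (hjk ▸ hjB)) (left_ne_zero_of_mul hj)
      (left_ne_zero_of_mul hk))
  have hg1 : γ * (reducedWeight HR g : ℝ) ≤ (hammingNorm (HS *ᵥ g) : ℝ) := by
    refine hconf g (le_trans ?_ (hf B hBf hBconn))
    have : hammingNorm g = B.card := by rw [← hgB]; rfl
    rw [← this]
    exact_mod_cast reducedWeight_le_hammingNorm HR g
  have hh1 := ih _ hhlt h (fun B' hB' => hf B' (hB'.trans hhsub)) rfl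
  have hadd : (reducedWeight HR f : ℝ) ≤ reducedWeight HR g + reducedWeight HR h := by
    rw [hgh]
    exact_mod_cast reducedWeight_add_le HR g h
  calc γ * (reducedWeight HR f : ℝ) ≤ γ * (reducedWeight HR g + reducedWeight HR h) := by gcongr
    _ ≤ (hammingNorm (HS *ᵥ f) : ℝ) := by rw [hsynd]; push_cast; linarith

lemma card_le_maxConn {n : ℕ} {G : SimpleGraph (Fin n)} {α : ℝ} {A B : Finset (Fin n)}
    (hB : (G.induce (B : Set (Fin n))).Connected) (hAB : α * (B.card : ℝ) ≤ ((A ∩ B).card : ℝ)) :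
    B.card ≤ maxConn G α A := by
  classical
  unfold maxConn
  refine Finset.le_sup (f := Finset.card) ?_
  rw [Finset.mem_filter]
  exact ⟨Finset.mem_univ _, hB, by convert hAB⟩

/-- Two correctable errors `r`, `r'` that differ by a low-weight `p` up to a vector of trivial
syndrome differ by `p` up to a stabilizer. A connected subset of the support of `r + r'` is at least
half filled by `r` or by `r'`, hence small, so that confinement bounds the reduced weight of
`r + r'` by its syndrome, which is the syndrome of `p`. -/
lemma exists_stabilizer_of_syndrome_eq_zero {m m' n : ℕ} {HR : Matrix (Fin m) (Fin n) (ZMod 2)}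
    {HS : Matrix (Fin m') (Fin n) (ZMod 2)} {G : SimpleGraph (Fin n)}
    (hG : ∀ i j k, j ≠ k → HS i j ≠ 0 → HS i k ≠ 0 → G.Adj j k) {d γ : ℝ}
    (hconf : ∀ x : BitVec2 (Fin n), (reducedWeight HR x : ℝ) ≤ d →
      γ * (reducedWeight HR x : ℝ) ≤ (hammingNorm (HS *ᵥ x) : ℝ)) (hγ : 0 < γ)
    {wBit : ℕ} (hcol : ∀ j, hammingNorm (fun i => HS i j) ≤ wBit)
    {r r' p : BitVec2 (Fin n)} (hr : (maxConn G (1 / 2) (bitSupport r) : ℝ) ≤ d / 2)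
    (hr' : (maxConn G (1 / 2) (bitSupport r') : ℝ) ≤ d / 2) {w : ℝ}
    (hp : (hammingNorm p : ℝ) ≤ w) (hw : w * (1 + wBit / γ) ≤ d)
    (hsynd : HS *ᵥ (r + r' + p) = 0) : ∃ u : Fin m → ZMod 2, r + r' + p = HRᵀ *ᵥ u := by
  classical
  have hsynd' : HS *ᵥ (r + r') = HS *ᵥ p := by
    rw [Matrix.mulVec_add] at hsynd
    have := (bitVec2_eq_add_iff (HS *ᵥ (r + r')) 0 (HS *ᵥ p)).1 hsynd.symm
    rwa [zero_add] at this
  have hd : 0 ≤ d := by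
    have : (0 : ℝ) ≤ (maxConn G (1 / 2) (bitSupport r) : ℝ) := Nat.cast_nonneg _
    linarith
  have hrr' : γ * (reducedWeight HR (r + r') : ℝ) ≤ (hammingNorm (HS *ᵥ (r + r')) : ℝ) := by
    refine confinement_of_connected_card_le hG hconf hγ.le (r + r') fun B hB hBconn => ?_
    have hcover : B ⊆ (bitSupport r ∩ B) ∪ (bitSupport r' ∩ B) := by
      intro j hj
      have : r j + r' j ≠ 0 := by simpa [bitSupport] using hB hj
      simp only [Finset.mem_union, Finset.mem_inter, hj, and_true, bitSupport, Finset.mem_filter,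
        Finset.mem_univ, true_and]
      by_contra! hcon
      exact this (by rw [hcon.1, hcon.2, add_zero])
    have hcard : (B.card : ℝ) ≤ (bitSupport r ∩ B).card + (bitSupport r' ∩ B).card := by
      exact_mod_cast (Finset.card_le_card hcover).trans (Finset.card_union_le _ _)
    rcases le_total ((1 / 2 : ℝ) * B.card) ((bitSupport r ∩ B).card : ℝ) with h | h
    · have : (B.card : ℝ) ≤ _ := Nat.cast_le.2 (card_le_maxConn hBconn h)
      linarith
    · have : (B.card : ℝ) ≤ _ := Nat.cast_le.2 (card_le_maxConn (α := 1 / 2) (A := bitSupport r') hBconn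
        (by linarith))
      linarith
  have hpw : (hammingNorm (HS *ᵥ p) : ℝ) ≤ wBit * w := by
    calc (hammingNorm (HS *ᵥ p) : ℝ) ≤ wBit * hammingNorm p := by
          exact_mod_cast hammingNorm_mulVec_le hcol p
      _ ≤ wBit * w := by gcongr
  have hred : (reducedWeight HR (r + r') : ℝ) ≤ wBit * w / γ := by
    rw [le_div_iff₀ hγ, mul_comm]
    rw [hsynd'] at hrr'
    exact hrr'.trans hpw
  have hsmall : (reducedWeight HR (r + r' + p) : ℝ) ≤ d := by
    have h1 : (reducedWeight HR (r + r' + p) : ℝ) ≤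
        reducedWeight HR (r + r') + reducedWeight HR p := by
      exact_mod_cast reducedWeight_add_le HR (r + r') p
    have h2 : (reducedWeight HR p : ℝ) ≤ hammingNorm p := by
      exact_mod_cast reducedWeight_le_hammingNorm HR p
    have h3 : w * (1 + wBit / γ) = w + wBit * w / γ := by ring
    linarith
  have hzero := hconf _ hsmall
  rw [hsynd, hammingNorm_zero, Nat.cast_zero] at hzero
  refine exists_eq_of_reducedWeight_eq_zero HR ?_
  have : (reducedWeight HR (r + r' + p) : ℝ) ≤ 0 := nonpos_of_mul_nonpos_right hzero hγ
  exact_mod_cast le_antisymm this (Nat.cast_nonneg _)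

/-! ### Knill–Laflamme conditions -/

lemma star_mulVec_dotProduct {ι : Type} [Fintype ι] (A : Matrix ι ι ℂ) (v w : ι → ℂ) :
    star (A *ᵥ v) ⬝ᵥ w = star v ⬝ᵥ (Aᴴ *ᵥ w) := by
  rw [Matrix.star_mulVec, ← Matrix.dotProduct_mulVec]

section Code

variable {n : ℕ} (C : CSSCode n)

lemma CSSCode.HZ_mul_HX_transpose : C.HZ * C.HXᵀ = 0 := by
  rw [← Matrix.transpose_transpose C.HZ, ← Matrix.transpose_mul, C.comm, Matrix.transpose_zero]

/-- The code space: all vectors, normalized or not, that are fixed by every check. -/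
def CSSCode.codeSpace : Submodule ℂ (QState (Fin n)) where
  carrier := {ψ | (∀ i, pauli (C.HX i) 0 *ᵥ ψ = ψ) ∧ ∀ i, pauli 0 (C.HZ i) *ᵥ ψ = ψ}
  add_mem' := fun h h' => ⟨fun i => by rw [Matrix.mulVec_add, h.1, h'.1],
    fun i => by rw [Matrix.mulVec_add, h.2, h'.2]⟩
  zero_mem' := ⟨fun i => Matrix.mulVec_zero _, fun i => Matrix.mulVec_zero _⟩
  smul_mem' := fun c ψ h => ⟨fun i => by rw [Matrix.mulVec_smul, h.1],
    fun i => by rw [Matrix.mulVec_smul, h.2]⟩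

variable {C}

lemma CSSCode.IsCodeState.mem_codeSpace {ψ : QState (Fin n)} (h : C.IsCodeState ψ) :
    ψ ∈ C.codeSpace := by
  refine ⟨fun i => ?_, fun i => ?_⟩
  · rw [pauli_mulVec]
    have : pauliZ (0 : BitVec2 (Fin n)) ψ = ψ := by
      ext s
      simp [pauliZ]
    rw [this, h.checkX]
  · rw [pauli_mulVec, h.checkZ]
    ext s
    simp [pauliX]

lemma transpose_mulVec_eq_sum {m : ℕ} (H : Matrix (Fin m) (Fin n) (ZMod 2)) (c : Fin m → ZMod 2) :
    Hᵀ *ᵥ c = ∑ i, c i • H i := by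
  ext j
  simp [Matrix.mulVec, dotProduct, Finset.sum_apply, mul_comm]

lemma pauli_transpose_mulVec_of_mem_codeSpace {ψ : QState (Fin n)} (hψ : ψ ∈ C.codeSpace)
    (c : Fin C.mX → ZMod 2) (c' : Fin C.mZ → ZMod 2) :
    pauli (C.HXᵀ *ᵥ c) (C.HZᵀ *ᵥ c') *ᵥ ψ = ψ := by
  have hX : ∀ s : Finset (Fin C.mX), pauli (∑ i ∈ s, c i • C.HX i) 0 *ᵥ ψ = ψ := by
    intro s
    induction s using Finset.induction_on with
    | empty => rw [Finset.sum_empty, pauli_zero_zero, Matrix.one_mulVec]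
    | insert i s hi ih =>
      have hmul := pauli_mul (c i • C.HX i) 0 (∑ i ∈ s, c i • C.HX i) 0
      rw [zero_dotProduct, bitSign_zero, one_smul, add_zero] at hmul
      rw [Finset.sum_insert hi, ← hmul, ← Matrix.mulVec_mulVec, ih]
      rcases zmod_two_eq_zero_or_one (c i) with h | h
      · rw [h, zero_smul, pauli_zero_zero, Matrix.one_mulVec]
      · rw [h, one_smul, hψ.1]
  have hZ : ∀ s : Finset (Fin C.mZ), pauli 0 (∑ i ∈ s, c' i • C.HZ i) *ᵥ ψ = ψ := by
    intro s
    induction s using Finset.induction_on with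
    | empty => rw [Finset.sum_empty, pauli_zero_zero, Matrix.one_mulVec]
    | insert i s hi ih =>
      have hmul := pauli_mul 0 (c' i • C.HZ i) 0 (∑ i ∈ s, c' i • C.HZ i)
      rw [dotProduct_zero, bitSign_zero, one_smul, add_zero] at hmul
      rw [Finset.sum_insert hi, ← hmul, ← Matrix.mulVec_mulVec, ih]
      rcases zmod_two_eq_zero_or_one (c' i) with h | h
      · rw [h, zero_smul, pauli_zero_zero, Matrix.one_mulVec]
      · rw [h, one_smul, hψ.2]
  have hmul := pauli_mul (C.HXᵀ *ᵥ c) 0 0 (C.HZᵀ *ᵥ c')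
  rw [zero_dotProduct, bitSign_zero, one_smul, add_zero, zero_add] at hmul
  rw [← hmul, ← Matrix.mulVec_mulVec, transpose_mulVec_eq_sum, transpose_mulVec_eq_sum, hZ, hX]

/-- If a stabilizer `S` anticommutes with `P`, then `P` has no matrix elements between stabilized
vectors. -/
lemma dotProduct_mulVec_eq_zero_of_anticommute {ι : Type} [Fintype ι] {S P : Matrix ι ι ℂ}
    (hS : Sᴴ = S) (hSP : S * P = -(P * S)) {ψ₁ ψ₂ : ι → ℂ} (h₁ : S *ᵥ ψ₁ = ψ₁) (h₂ : S *ᵥ ψ₂ = ψ₂) :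
    star ψ₁ ⬝ᵥ (P *ᵥ ψ₂) = 0 := by
  have h : star ψ₁ ⬝ᵥ (P *ᵥ ψ₂) = -(star ψ₁ ⬝ᵥ (P *ᵥ ψ₂)) := by
    conv_lhs => rw [← h₁]
    rw [star_mulVec_dotProduct, hS, Matrix.mulVec_mulVec, hSP, Matrix.neg_mulVec,
      ← Matrix.mulVec_mulVec, h₂, dotProduct_neg]
  exact self_eq_neg.1 h

/-- A Pauli string each of whose two parts is either detected by a check or a product of checks acts
as a scalar within the code space. -/
lemma exists_scalar_pauli {u v : BitVec2 (Fin n)}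
    (hu : C.HZ *ᵥ u = 0 → ∃ c, u = C.HXᵀ *ᵥ c) (hv : C.HX *ᵥ v = 0 → ∃ c, v = C.HZᵀ *ᵥ c) :
    ∃ μ : ℂ, ∀ ψ₁ ∈ C.codeSpace, ∀ ψ₂ ∈ C.codeSpace,
      star ψ₁ ⬝ᵥ (pauli u v *ᵥ ψ₂) = μ * (star ψ₁ ⬝ᵥ ψ₂) := by
  have hne : ∀ x : ZMod 2, x ≠ 0 → x = 1 := by decide
  by_cases h1 : C.HZ *ᵥ u = 0
  · by_cases h2 : C.HX *ᵥ v = 0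
    · obtain ⟨c, rfl⟩ := hu h1
      obtain ⟨c', rfl⟩ := hv h2
      exact ⟨1, fun ψ₁ _ ψ₂ hψ₂ => by
        rw [pauli_transpose_mulVec_of_mem_codeSpace hψ₂, one_mul]⟩
    · obtain ⟨i, hi⟩ := Function.ne_iff.1 h2
      have hi1 : v ⬝ᵥ C.HX i = 1 := by
        rw [dotProduct_comm]
        exact hne _ hi
      refine ⟨0, fun ψ₁ hψ₁ ψ₂ hψ₂ => ?_⟩
      rw [zero_mul]
      refine dotProduct_mulVec_eq_zero_of_anticommute (S := pauli (C.HX i) 0) ?_ ?_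
        (hψ₁.1 i) (hψ₂.1 i)
      · rw [pauli_conjTranspose, zero_dotProduct, bitSign_zero, one_smul]
      · rw [pauli_mul, pauli_mul, hi1, zero_dotProduct, bitSign_zero, bitSign_one, one_smul,
          neg_smul, one_smul, neg_neg, add_comm u, add_comm v]
  · obtain ⟨i, hi⟩ := Function.ne_iff.1 h1
    have hi1 : C.HZ i ⬝ᵥ u = 1 := hne _ hi
    refine ⟨0, fun ψ₁ hψ₁ ψ₂ hψ₂ => ?_⟩
    rw [zero_mul]
    refine dotProduct_mulVec_eq_zero_of_anticommute (S := pauli 0 (C.HZ i)) ?_ ?_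
      (hψ₁.2 i) (hψ₂.2 i)
    · rw [pauli_conjTranspose, dotProduct_zero, bitSign_zero, one_smul]
    · rw [pauli_mul, pauli_mul, hi1, dotProduct_zero, bitSign_zero, bitSign_one, one_smul,
        neg_smul, one_smul, add_comm u, add_comm v]

variable (C) in
/-- The span of the Pauli strings `X^x Z^z` with `x ∈ Ω_X(x₀)` and `z ∈ Ω_Z(z₀)`. -/
def CSSCode.errorSpan (d : ℝ) (x₀ z₀ : BitVec2 (Fin n)) : Submodule ℂ (QOp (Fin n)) :=
  Submodule.span ℂ {P | ∃ x ∈ C.Omega C.HX d x₀, ∃ z ∈ C.Omega C.HZ d z₀, P = pauli x z}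

lemma exists_mem_errorSpan_of_mem_V {d : ℝ} {ψ : QState (Fin n)} {x₀ z₀ : BitVec2 (Fin n)}
    {φ : QState (Fin n)} (hφ : φ ∈ C.V d ψ x₀ z₀) : ∃ R ∈ C.errorSpan d x₀ z₀, R *ᵥ ψ = φ := by
  induction hφ using Submodule.span_induction with
  | mem φ h =>
    obtain ⟨x, hx, z, hz, rfl⟩ := h
    exact ⟨pauli x z, Submodule.subset_span ⟨x, hx, z, hz, rfl⟩, pauli_mulVec x z ψ⟩
  | zero => exact ⟨0, Submodule.zero_mem _, Matrix.zero_mulVec ψ⟩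
  | add φ φ' _ _ h h' =>
    obtain ⟨R, hR, rfl⟩ := h
    obtain ⟨R', hR', rfl⟩ := h'
    exact ⟨R + R', Submodule.add_mem _ hR hR', Matrix.add_mulVec _ _ _⟩
  | smul c φ _ h =>
    obtain ⟨R, hR, rfl⟩ := h
    exact ⟨c • R, Submodule.smul_mem _ _ hR, Matrix.smul_mulVec _ _ _⟩

lemma exists_stabilizer_of_mem_Omega {m m' : ℕ} {HR : Matrix (Fin m) (Fin n) (ZMod 2)}
    {HS : Matrix (Fin m') (Fin n) (ZMod 2)} (hcomm : HS * HRᵀ = 0)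
    (hG : ∀ i j k, j ≠ k → HS i j ≠ 0 → HS i k ≠ 0 → C.interactionGraph.Adj j k) {d γ : ℝ}
    (hconf : ∀ x : BitVec2 (Fin n), (reducedWeight HR x : ℝ) ≤ d →
      γ * (reducedWeight HR x : ℝ) ≤ (hammingNorm (HS *ᵥ x) : ℝ)) (hγ : 0 < γ)
    {wBit : ℕ} (hcol : ∀ j, hammingNorm (fun i => HS i j) ≤ wBit) {w : ℝ}
    (hw : w * (1 + wBit / γ) ≤ d) {x₀ x x' a : BitVec2 (Fin n)} (hx : x ∈ C.Omega HR d x₀)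
    (hx' : x' ∈ C.Omega HR d x₀) (ha : (hammingNorm a : ℝ) ≤ w) (h0 : HS *ᵥ (x + a + x') = 0) :
    ∃ c, x + a + x' = HRᵀ *ᵥ c := by
  obtain ⟨y, r, rfl, ⟨⟨u, rfl⟩, -⟩, hr⟩ := hx
  obtain ⟨y', r', rfl, ⟨⟨u', rfl⟩, -⟩, hr'⟩ := hx'
  have key : x₀ + y + a + (x₀ + y') =
      (y + HRᵀ *ᵥ u) + (y' + HRᵀ *ᵥ u') + a + HRᵀ *ᵥ (u + u') := by
    rw [Matrix.mulVec_add]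
    generalize HRᵀ *ᵥ u = p
    generalize HRᵀ *ᵥ u' = p'
    ext j
    simp only [Pi.add_apply]
    generalize x₀ j = s₁
    generalize y j = s₂
    generalize y' j = s₃
    generalize a j = s₄
    generalize p j = s₅
    generalize p' j = s₆
    have e₁ := CharTwo.add_self_eq_zero s₁
    have e₂ := CharTwo.add_self_eq_zero s₅
    have e₃ := CharTwo.add_self_eq_zero s₆
    linear_combination e₁ - e₂ - e₃
  rw [key, Matrix.mulVec_add, Matrix.mulVec_mulVec, hcomm, Matrix.zero_mulVec, add_zero] at h0
  obtain ⟨c, hc⟩ := exists_stabilizer_of_syndrome_eq_zero hG hconf hγ hcol hr hr' ha hw h0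
  exact ⟨c + (u + u'), by rw [key, hc, Matrix.mulVec_add HRᵀ c]⟩

/-- The Knill–Laflamme conditions for the errors that span `𝒱(x₀, z₀)` and Pauli strings of low
weight. -/
lemma exists_scalar_error_pauli_error {d γ : ℝ} (hconf : C.Confines d γ) (hγ : 0 < γ)
    {wCheck wBit : ℕ} (hX : HasDegreesLE C.HX wCheck wBit) (hZ : HasDegreesLE C.HZ wCheck wBit)
    {w : ℝ} (hw : w * (1 + wBit / γ) ≤ d) {x₀ z₀ : BitVec2 (Fin n)} {R R' : QOp (Fin n)}
    (hR : R ∈ C.errorSpan d x₀ z₀) (hR' : R' ∈ C.errorSpan d x₀ z₀) {a b : BitVec2 (Fin n)}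
    (ha : (hammingNorm a : ℝ) ≤ w) (hb : (hammingNorm b : ℝ) ≤ w) :
    ∃ μ : ℂ, ∀ ψ₁ ∈ C.codeSpace, ∀ ψ₂ ∈ C.codeSpace,
      star (R *ᵥ ψ₁) ⬝ᵥ (pauli a b *ᵥ (R' *ᵥ ψ₂)) = μ * (star ψ₁ ⬝ᵥ ψ₂) := by
  induction hR using Submodule.span_induction with
  | mem P hP =>
    obtain ⟨x, hx, z, hz, rfl⟩ := hP
    induction hR' using Submodule.span_induction with
    | mem P hP =>
      obtain ⟨x', hx', z', hz', rfl⟩ := hP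
      obtain ⟨μ, hμ⟩ := exists_scalar_pauli (C := C) (u := x + a + x') (v := z + b + z')
        (fun h0 => exists_stabilizer_of_mem_Omega C.HZ_mul_HX_transpose
          (fun i j k hjk hj hk => ⟨hjk, Or.inr ⟨i, hj, hk⟩⟩) hconf.1 hγ hZ.2 hw hx hx' ha h0)
        (fun h0 => exists_stabilizer_of_mem_Omega C.comm
          (fun i j k hjk hj hk => ⟨hjk, Or.inl ⟨i, hj, hk⟩⟩) hconf.2 hγ hX.2 hw hz hz' hb h0)
      refine ⟨bitSign (z ⬝ᵥ x) * (bitSign (z ⬝ᵥ a) * (bitSign ((z + b) ⬝ᵥ x') * μ)),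
        fun ψ₁ h₁ ψ₂ h₂ => ?_⟩
      rw [star_mulVec_dotProduct, Matrix.mulVec_mulVec, Matrix.mulVec_mulVec, pauli_conjTranspose,
        Matrix.smul_mul, pauli_mul, Matrix.smul_mul, Matrix.smul_mul, pauli_mul,
        Matrix.smul_mulVec, Matrix.smul_mulVec, Matrix.smul_mulVec, dotProduct_smul,
        dotProduct_smul, dotProduct_smul, hμ ψ₁ h₁ ψ₂ h₂]
      simp only [smul_eq_mul, mul_assoc]
    | zero => exact ⟨0, fun _ _ _ _ => by simp⟩
    | add A B _ _ hA hB =>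
      obtain ⟨μ, hμ⟩ := hA
      obtain ⟨ν, hν⟩ := hB
      exact ⟨μ + ν, fun ψ₁ h₁ ψ₂ h₂ => by
        rw [Matrix.add_mulVec, Matrix.mulVec_add, dotProduct_add, hμ ψ₁ h₁ ψ₂ h₂,
          hν ψ₁ h₁ ψ₂ h₂, add_mul]⟩
    | smul c A _ hA =>
      obtain ⟨μ, hμ⟩ := hA
      exact ⟨c * μ, fun ψ₁ h₁ ψ₂ h₂ => by
        rw [Matrix.smul_mulVec, Matrix.mulVec_smul, dotProduct_smul, hμ ψ₁ h₁ ψ₂ h₂, smul_eq_mul,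
          mul_assoc]⟩
  | zero => exact ⟨0, fun _ _ _ _ => by simp⟩
  | add A B _ _ hA hB =>
    obtain ⟨μ, hμ⟩ := hA
    obtain ⟨ν, hν⟩ := hB
    exact ⟨μ + ν, fun ψ₁ h₁ ψ₂ h₂ => by
      rw [Matrix.add_mulVec, star_add, add_dotProduct, hμ ψ₁ h₁ ψ₂ h₂, hν ψ₁ h₁ ψ₂ h₂, add_mul]⟩
  | smul c A _ hA =>
    obtain ⟨μ, hμ⟩ := hA
    exact ⟨star c * μ, fun ψ₁ h₁ ψ₂ h₂ => by
      rw [Matrix.smul_mulVec, star_smul, smul_dotProduct, hμ ψ₁ h₁ ψ₂ h₂, smul_eq_mul, mul_assoc]⟩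

/-! ### Orthogonal code vectors -/

lemma exists_logical (hk : 1 ≤ C.numLogical) :
    ∃ v : BitVec2 (Fin n), C.HZ *ᵥ v = 0 ∧ ∀ c, v ≠ C.HXᵀ *ᵥ c := by
  by_contra! hcon
  have hle : LinearMap.ker C.HZ.mulVecLin ≤ LinearMap.range C.HXᵀ.mulVecLin := by
    intro v hv
    obtain ⟨c, hc⟩ := hcon v hv
    exact ⟨c, hc.symm⟩
  have h1 := Submodule.finrank_mono hle
  have h2 := C.HZ.mulVecLin.finrank_range_add_finrank_ker
  have h3 : Module.finrank (ZMod 2) (LinearMap.range C.HXᵀ.mulVecLin) = C.HX.rank :=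
    C.HX.rank_transpose
  have h4 : Module.finrank (ZMod 2) (LinearMap.range C.HZ.mulVecLin) = C.HZ.rank := rfl
  rw [Module.finrank_fin_fun] at h2
  unfold CSSCode.numLogical at hk
  omega

open Classical in
variable (C) in
/-- The unnormalized uniform superposition of the coset `v + Im H_Xᵀ`. -/
noncomputable def CSSCode.cosetState (v : BitVec2 (Fin n)) : QState (Fin n) :=
  fun s => if ∃ c, s = v + C.HXᵀ *ᵥ c then 1 else 0

lemma cosetState_mem_codeSpace {v : BitVec2 (Fin n)} (hv : C.HZ *ᵥ v = 0) :
    C.cosetState v ∈ C.codeSpace := by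
  refine ⟨fun i => ?_, fun i => ?_⟩
  · ext s
    rw [pauli_mulVec_apply, zero_dotProduct, bitSign_zero, one_mul]
    have hrow : C.HXᵀ *ᵥ Pi.single i 1 = C.HX i := by
      rw [Matrix.mulVec_single_one]
      rfl
    have : (∃ c, s + C.HX i = v + C.HXᵀ *ᵥ c) ↔ ∃ c, s = v + C.HXᵀ *ᵥ c := by
      constructor
      · rintro ⟨c, hc⟩
        refine ⟨c + Pi.single i 1, ?_⟩
        rw [Matrix.mulVec_add, hrow, ← add_assoc]
        exact (bitVec2_eq_add_iff s _ _).1 hc.symm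
      · rintro ⟨c, rfl⟩
        exact ⟨c + Pi.single i 1, by rw [Matrix.mulVec_add, hrow, add_assoc]⟩
    simp only [CSSCode.cosetState, this]
  · ext s
    rw [pauli_mulVec_apply, add_zero]
    by_cases hs : ∃ c, s = v + C.HXᵀ *ᵥ c
    · obtain ⟨c, rfl⟩ := hs
      have h0 : C.HZ *ᵥ (v + C.HXᵀ *ᵥ c) = 0 := by
        rw [Matrix.mulVec_add, hv, Matrix.mulVec_mulVec, C.HZ_mul_HX_transpose,
          Matrix.zero_mulVec, add_zero]
      have h1 : C.HZ i ⬝ᵥ (v + C.HXᵀ *ᵥ c) = 0 := congrFun h0 i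
      rw [h1, bitSign_zero, one_mul]
    · simp only [CSSCode.cosetState, if_neg hs, mul_zero]

lemma exists_orthogonal_mem_codeSpace (hk : 1 ≤ C.numLogical) (ψ : QState (Fin n)) :
    ∃ ψ' ∈ C.codeSpace, ψ' ≠ 0 ∧ star ψ ⬝ᵥ ψ' = 0 := by
  obtain ⟨v, hv, hvX⟩ := exists_logical hk
  have h0 : C.cosetState 0 ∈ C.codeSpace := cosetState_mem_codeSpace (Matrix.mulVec_zero _)
  have h1 : C.cosetState v ∈ C.codeSpace := cosetState_mem_codeSpace hv
  have h00 : C.cosetState 0 0 = 1 := if_pos ⟨0, by simp⟩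
  have h1v : C.cosetState v v = 1 := if_pos ⟨0, by simp⟩
  have h0v : C.cosetState 0 v = 0 := if_neg (by simpa using hvX)
  by_cases hα : star ψ ⬝ᵥ C.cosetState 0 = 0
  · exact ⟨_, h0, fun h => by simp [h] at h00, hα⟩
  · refine ⟨(star ψ ⬝ᵥ C.cosetState v) • C.cosetState 0 - (star ψ ⬝ᵥ C.cosetState 0) •
      C.cosetState v, Submodule.sub_mem _ (Submodule.smul_mem _ _ h0) (Submodule.smul_mem _ _ h1),
      fun h => hα ?_, ?_⟩
    · simpa [h0v, h1v] using congrFun h v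
    · rw [dotProduct_sub, dotProduct_smul, dotProduct_smul, smul_eq_mul, smul_eq_mul, mul_comm,
        sub_self]

end Code

/-! ### Ancillas -/

section Tensor

variable {Q Q' : Type}

/-- The product state `φ ⊗ χ`. -/
def tensorState (φ : QState Q) (χ : QState Q') : QState (Q ⊕ Q') :=
  fun s => φ (fun j => s (Sum.inl j)) * χ (fun j => s (Sum.inr j))

variable [Fintype Q] [Fintype Q'] [DecidableEq Q] [DecidableEq Q']

lemma star_tensorState_dotProduct (φ φ' : QState Q) (χ χ' : QState Q') :
    star (tensorState φ χ) ⬝ᵥ tensorState φ' χ' = (star φ ⬝ᵥ φ') * (star χ ⬝ᵥ χ') := by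
  unfold dotProduct
  rw [Finset.sum_mul_sum, ← Finset.sum_product', Finset.univ_product_univ]
  refine Fintype.sum_equiv (Equiv.sumArrowEquivProdArrow Q Q' (ZMod 2)) _ _ fun s => ?_
  simp only [tensorState, Pi.star_apply, star_mul', Equiv.sumArrowEquivProdArrow,
    Equiv.coe_fn_mk]
  simp only [Function.comp_def]
  ring

lemma pauli_mulVec_tensorState (a b : BitVec2 (Q ⊕ Q')) (φ : QState Q) (χ : QState Q') :
    pauli a b *ᵥ tensorState φ χ =
      tensorState (pauli (fun j => a (Sum.inl j)) (fun j => b (Sum.inl j)) *ᵥ φ)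
        (pauli (fun j => a (Sum.inr j)) (fun j => b (Sum.inr j)) *ᵥ χ) := by
  ext s
  have hdot : b ⬝ᵥ (s + a) =
      (fun j => b (Sum.inl j)) ⬝ᵥ ((fun j => s (Sum.inl j)) + fun j => a (Sum.inl j)) +
      (fun j => b (Sum.inr j)) ⬝ᵥ ((fun j => s (Sum.inr j)) + fun j => a (Sum.inr j)) := by
    simp only [dotProduct, Fintype.sum_sum_type, Pi.add_apply]
  simp only [tensorState, pauli_mulVec_apply]
  rw [hdot, bitSign_add, mul_mul_mul_comm]
  rfl

end Tensor

/-! ### Local indistinguishability and shallow circuits -/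

section Depth

variable {n : ℕ} {C : CSSCode n}

/-- The Knill–Laflamme conditions for all operators supported on few qubits and ancillas. -/
lemma exists_scalar_error_supportedOps_error {d γ : ℝ} (hconf : C.Confines d γ) (hγ : 0 < γ)
    {wCheck wBit : ℕ} (hX : HasDegreesLE C.HX wCheck wBit) (hZ : HasDegreesLE C.HZ wCheck wBit)
    {w : ℕ} (hw : (w : ℝ) * (1 + wBit / γ) ≤ d) {x₀ z₀ : BitVec2 (Fin n)} {R : QOp (Fin n)}
    (hR : R ∈ C.errorSpan d x₀ z₀) {a : ℕ} (χ : QState (Fin a)) {T : Finset (Fin n ⊕ Fin a)}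
    (hT : T.card ≤ w) {A : QOp (Fin n ⊕ Fin a)} (hA : A ∈ supportedOps T) :
    ∃ μ : ℂ, ∀ ψ₁ ∈ C.codeSpace, ∀ ψ₂ ∈ C.codeSpace,
      star (tensorState (R *ᵥ ψ₁) χ) ⬝ᵥ (A *ᵥ tensorState (R *ᵥ ψ₂) χ) =
        μ * (star ψ₁ ⬝ᵥ ψ₂) := by
  induction hA using Submodule.span_induction with
  | mem P hP =>
    obtain ⟨p, q, hp, hq, rfl⟩ := hP
    have hweight : ∀ p : BitVec2 (Fin n ⊕ Fin a), (∀ j, j ∉ T → p j = 0) →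
        (hammingNorm (fun j => p (Sum.inl j)) : ℝ) ≤ w := by
      intro p hp
      refine Nat.cast_le.2 (le_trans ?_ hT)
      refine Finset.card_le_card_of_injOn Sum.inl ?_ Sum.inl_injective.injOn
      intro j hj
      by_contra hjT
      simp only [Finset.coe_filter, Finset.mem_univ, true_and, Set.mem_ofPred_eq] at hj
      exact hj (hp _ hjT)
    obtain ⟨μ, hμ⟩ := exists_scalar_error_pauli_error hconf hγ hX hZ hw hR hR (hweight p hp)
      (hweight q hq)
    refine ⟨μ * (star χ ⬝ᵥ
      (pauli (fun j => p (Sum.inr j)) (fun j => q (Sum.inr j)) *ᵥ χ)), fun ψ₁ h₁ ψ₂ h₂ => ?_⟩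
    rw [pauli_mulVec_tensorState, star_tensorState_dotProduct, hμ ψ₁ h₁ ψ₂ h₂]
    ring
  | zero => exact ⟨0, fun _ _ _ _ => by simp⟩
  | add A B _ _ hA hB =>
    obtain ⟨μ, hμ⟩ := hA
    obtain ⟨ν, hν⟩ := hB
    exact ⟨μ + ν, fun ψ₁ h₁ ψ₂ h₂ => by
      rw [Matrix.add_mulVec, dotProduct_add, hμ ψ₁ h₁ ψ₂ h₂, hν ψ₁ h₁ ψ₂ h₂, add_mul]⟩
  | smul c A _ hA =>
    obtain ⟨μ, hμ⟩ := hA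
    exact ⟨c * μ, fun ψ₁ h₁ ψ₂ h₂ => by
      rw [Matrix.smul_mulVec, dotProduct_smul, hμ ψ₁ h₁ ψ₂ h₂, smul_eq_mul, mul_assoc]⟩

open scoped ComplexOrder in
/-- If the conjugates `U Π_j Uᴴ` of the projectors `Π_j = |1⟩⟨1|_j` have vanishing expectation in
`Φ`, then `Φ` is proportional to `U |0…0⟩`. -/
lemma exists_eq_smul_of_expectation_eq_zero {Q : Type} [Fintype Q] [DecidableEq Q] {U : QOp Q}
    (hU : U ∈ Matrix.unitaryGroup (BitVec2 Q) ℂ) {Φ : QState Q}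
    (h : ∀ j, star Φ ⬝ᵥ ((U * Matrix.diagonal (fun t : BitVec2 Q => if t j = 1 then (1 : ℂ) else 0)
      * Uᴴ) *ᵥ Φ) = 0) : ∃ c : ℂ, Φ = c • (U *ᵥ zeroState Q) := by
  have hzero : ∀ j, ∀ t : BitVec2 Q, t j = 1 → (Uᴴ *ᵥ Φ) t = 0 := by
    intro j t ht
    set Pj : QOp Q := Matrix.diagonal (fun t : BitVec2 Q => if t j = 1 then (1 : ℂ) else 0) with hPj
    have hproj : Pjᴴ * Pj = Pj := by
      rw [hPj, Matrix.diagonal_conjTranspose, Matrix.diagonal_mul_diagonal]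
      congr 1
      ext t
      by_cases h1 : t j = 1 <;> simp [h1]
    have hj : star Φ ⬝ᵥ ((U * Pj * Uᴴ) *ᵥ Φ) = 0 := h j
    rw [← hproj] at hj
    have hsq : star (Pj *ᵥ (Uᴴ *ᵥ Φ)) ⬝ᵥ (Pj *ᵥ (Uᴴ *ᵥ Φ)) = 0 := by
      rw [star_mulVec_dotProduct, star_mulVec_dotProduct, Matrix.conjTranspose_conjTranspose, ← hj]
      simp only [Matrix.mulVec_mulVec, Matrix.mul_assoc]
    have hvan := dotProduct_star_self_eq_zero.1 hsq
    have := congrFun hvan t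
    rwa [hPj, Matrix.mulVec_diagonal, if_pos ht, one_mul] at this
  refine ⟨(Uᴴ *ᵥ Φ) 0, ?_⟩
  have hΦ : Uᴴ *ᵥ Φ = (Uᴴ *ᵥ Φ) 0 • zeroState Q := by
    ext t
    by_cases ht : t = 0
    · subst ht
      simp [zeroState]
    · obtain ⟨j, hj⟩ := Function.ne_iff.1 ht
      rw [hzero j t ((zmod_two_eq_zero_or_one (t j)).resolve_left hj)]
      simp [zeroState, ht]
  have hUU : U * Uᴴ = 1 := Matrix.mem_unitaryGroup_iff.1 hU
  rw [← Matrix.mulVec_smul, ← hΦ, Matrix.mulVec_mulVec, hUU, Matrix.one_mulVec]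

open scoped ComplexOrder in
/-- A circuit whose light cones are too small to violate the Knill–Laflamme conditions prepares no
state of `𝒱(x₀, z₀)`. -/
lemma not_preparable_of_mem_V (hk : 1 ≤ C.numLogical) {d γ : ℝ} (hconf : C.Confines d γ)
    (hγ : 0 < γ) {wCheck wBit : ℕ} (hX : HasDegreesLE C.HX wCheck wBit)
    (hZ : HasDegreesLE C.HZ wCheck wBit) {q D : ℕ}
    (hw : (((q + 1) ^ D : ℕ) : ℝ) * (1 + wBit / γ) ≤ d) {ψ : QState (Fin n)}
    (hψ : C.IsCodeState ψ) {x₀ z₀ : BitVec2 (Fin n)} {φ : QState (Fin n)}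
    (hφ : φ ∈ C.V d ψ x₀ z₀) : ¬ Preparable q D φ := by
  rintro ⟨a, U, χ, hU, hprep⟩
  obtain ⟨R, hR, rfl⟩ := exists_mem_errorSpan_of_mem_V hφ
  obtain ⟨ψ', hψ', hψ'0, horth⟩ := exists_orthogonal_mem_codeSpace hk ψ
  have hψm := hψ.mem_codeSpace
  have hψψ : star ψ ⬝ᵥ ψ = 1 := by
    have h1 : ((∑ s, ‖ψ s‖ ^ 2 : ℝ) : ℂ) = 1 := by rw [hψ.normalized, Complex.ofReal_one]
    rw [← h1, dotProduct, Complex.ofReal_sum]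
    refine Finset.sum_congr rfl fun s _ => ?_
    rw [Pi.star_apply, Complex.ofReal_pow]
    exact Complex.conj_mul' (ψ s)
  change U *ᵥ zeroState (Fin n ⊕ Fin a) = tensorState (R *ᵥ ψ) χ at hprep
  have hunit := hU.mem_unitaryGroup
  have hUU : Uᴴ * U = 1 := Matrix.mem_unitaryGroup_iff'.1 hunit
  have hnorm : star (tensorState (R *ᵥ ψ) χ) ⬝ᵥ tensorState (R *ᵥ ψ) χ = 1 := by
    rw [← hprep, star_mulVec_dotProduct, Matrix.mulVec_mulVec, hUU, Matrix.one_mulVec]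
    simp [zeroState]
  -- `R` preserves inner products of code vectors up to a common factor, which is nonzero.
  obtain ⟨μ, hμ⟩ := exists_scalar_error_supportedOps_error hconf hγ hX hZ hw hR χ
    (T := ∅) (by simp) (one_mem_supportedOps ∅)
  simp only [Matrix.one_mulVec] at hμ
  have hμ1 : μ = 1 := by
    have := hμ ψ hψm ψ hψm
    rw [hnorm, hψψ, mul_one] at this
    exact this.symm
  obtain ⟨c, hc⟩ : ∃ c : ℂ, tensorState (R *ᵥ ψ') χ = c • (U *ᵥ zeroState (Fin n ⊕ Fin a)) := by
    refine exists_eq_smul_of_expectation_eq_zero hunit fun j => ?_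
    have hmem : Matrix.diagonal
        (fun t : BitVec2 (Fin n ⊕ Fin a) => if t j = 1 then (1 : ℂ) else 0) ∈
        supportedOps {j} := by
      simpa using diagonal_agree_mem_supportedOps (subset_refl {j})
        (fun _ => 1 : BitVec2 (Fin n ⊕ Fin a))
    obtain ⟨T, hT, hTmem⟩ := hU.exists_support_conj {j} hmem
    rw [Finset.card_singleton, mul_one] at hT
    obtain ⟨ν, hν⟩ := exists_scalar_error_supportedOps_error hconf hγ hX hZ hw hR χ hT hTmem
    have hν0 : ν = 0 := by
      have := hν ψ hψm ψ hψm
      rw [hψψ, mul_one] at this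
      rw [← this, ← hprep, Matrix.mulVec_mulVec, Matrix.mul_assoc _ Uᴴ U, hUU, Matrix.mul_one,
        ← Matrix.mulVec_mulVec]
      have hz : Matrix.diagonal
          (fun t : BitVec2 (Fin n ⊕ Fin a) => if t j = 1 then (1 : ℂ) else 0) *ᵥ
          zeroState (Fin n ⊕ Fin a) = 0 := by
        ext t
        rw [Matrix.mulVec_diagonal]
        by_cases ht : t = 0
        · subst ht
          simp
        · simp [zeroState, ht]
      rw [hz, Matrix.mulVec_zero, dotProduct_zero]
    rw [hν ψ' hψ' ψ' hψ', hν0, zero_mul]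
  rw [hprep] at hc
  have hc0 : c = 0 := by
    have := hμ ψ hψm ψ' hψ'
    rw [hc, dotProduct_smul, hnorm, horth, mul_zero, smul_eq_mul, mul_one] at this
    exact this
  have := hμ ψ' hψ' ψ' hψ'
  rw [hc, hc0, zero_smul, dotProduct_zero, hμ1, one_mul] at this
  exact hψ'0 (dotProduct_star_self_eq_zero.1 this.symm)

end Depth

/-! ### The depth bound -/

theorem mainTheorem5
    -- a family of CSS codes, the `i`-th one on `N i` qubits
    (N : ℕ → ℕ) (hN : Tendsto N atTop atTop) (C : ∀ i, CSSCode (N i))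
    -- LDPC
    (wCheck wBit : ℕ)
    (hX : ∀ i, HasDegreesLE (C i).HX wCheck wBit) (hZ : ∀ i, HasDegreesLE (C i).HZ wCheck wBit)
    -- finite rate
    (r : ℝ) (hr : 0 < r) (hrate : ∀ᶠ i in atTop, r * (N i : ℝ) ≤ ((C i).numLogical : ℝ))
    -- linear confinement
    (δ : ℕ → ℝ) (hmono : Monotone δ) (hdiv : Tendsto δ atTop atTop)
    (hlog : Tendsto (fun n : ℕ => Real.log n / δ n) atTop (𝓝 0))
    (γ : ℝ) (hγ : 0 < γ) (hconf : ∀ i, (C i).Confines (δ (N i)) γ)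
    -- locality of the gates
    (q : ℕ) :
    ∃ c : ℝ, 0 < c ∧ ∀ᶠ i in atTop,
      ∀ ψ : QState (Fin (N i)), (C i).IsCodeState ψ →
      ∀ x₀ z₀ : BitVec2 (Fin (N i)),
      ∀ φ ∈ (C i).V (δ (N i)) ψ x₀ z₀,
      ∀ D : ℕ, Preparable q D φ → c * Real.logb 2 (δ (N i)) ≤ (D : ℝ) := by
  set K : ℝ := 1 + wBit / γ with hK
  have hK0 : 0 < K := by positivity
  have hq : 0 < Real.logb 2 ((q : ℝ) + 2) :=
    Real.logb_pos one_lt_two (by have : (0 : ℝ) ≤ q := Nat.cast_nonneg q; linarith)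
  -- With this constant, a smaller depth makes the light cones at most `√δ`, and `K √δ ≤ δ` for
  -- large `δ`.
  refine ⟨1 / (2 * Real.logb 2 ((q : ℝ) + 2)), by positivity, ?_⟩
  filter_upwards [hrate, hN.eventually_ge_atTop 1,
    (hdiv.comp hN).eventually_ge_atTop (max 1 (K ^ 2))] with i hi hNi hδ ψ hψ x₀ z₀ φ hφ D hprep
  have hδ1 : 1 ≤ δ (N i) := (le_max_left _ _).trans hδ
  have hδK : K ^ 2 ≤ δ (N i) := (le_max_right _ _).trans hδ
  have hk : 1 ≤ (C i).numLogical := by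
    have hNpos : (0 : ℝ) < N i := by exact_mod_cast hNi
    have : (0 : ℝ) < (C i).numLogical := (mul_pos hr hNpos).trans_le hi
    exact_mod_cast this
  by_contra! hD
  refine not_preparable_of_mem_V hk (hconf i) hγ (hX i) (hZ i) (q := q) (D := D) ?_ hψ hφ hprep
  have hcone : (((q + 1) ^ D : ℕ) : ℝ) ≤ √(δ (N i)) := by
    have h1 : (((q + 1) ^ D : ℕ) : ℝ) ≤ ((q : ℝ) + 2) ^ D := by
      push_cast
      gcongr
      norm_num
    refine h1.trans ?_
    rw [← Real.logb_le_logb one_lt_two (by positivity) (by positivity), Real.logb_pow,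
      Real.sqrt_eq_rpow, Real.logb_rpow_eq_mul_logb_of_pos (by positivity)]
    rw [div_mul_eq_mul_div, one_mul, lt_div_iff₀ (by positivity)] at hD
    linarith
  have hKs : K ≤ √(δ (N i)) := Real.le_sqrt_of_sq_le hδK
  calc (((q + 1) ^ D : ℕ) : ℝ) * K ≤ √(δ (N i)) * √(δ (N i)) := by gcongr
    _ = δ (N i) := Real.mul_self_sqrt (by positivity)
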